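/- Theorem (Yoneda completion). Let $[0,\infty)$ denote the non-negative reals. A coflow on a category $\mathcal C$ consists of endofunctors $T_\varepsilon$ ($\varepsilon\ge 0$), natural transformations $T_\varepsilon\Rightarrow T_\delta$ for $\delta\le\varepsilon$ that are functorial in the pair $\delta\le\varepsilon$ (the identity for $\delta=\varepsilon$, and compatible with composition), a counit $T_0\Rightarrow \mathrm{Id}$ and comultiplications $T_{\varepsilon+\delta}\Rightarrow T_\varepsilon T_\delta$ that are counital, coassociative and compatible with the transformations $T_\varepsilon\Rightarrow T_\delta$; it is strict if the counit and the comultiplications are identities. A functor $H:(\mathcal C,T_\varepsilon)\to(\mathcal D,S_\varepsilon)$ between categories with a coflow is strict coflow-equivariant if $HT_\varepsilon=S_\varepsilon H$ for all $\varepsilon$ and these equalities are compatible with the transition maps, counits and comultiplications. Objects $A,B$ are weakly $\varepsilon$-interleaved if there are maps $\alpha:T_\varepsilon B\to A$, $\beta:T_\varepsilon A\to B$ such that $T_{2\varepsilon}A\to T_\varepsilon T_\varepsilon A\xrightarrow{T_\varepsilon\beta}T_\varepsilon B\xrightarrow{\alpha}A$ equals $T_{2\varepsilon}A\to T_0A\to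 A$, and likewise with the roles of $(A,\beta)$ and $(B,\alpha)$ exchanged; $d(A,B)\in[0,\infty]$ is the infimum of all such $\varepsilon$. The category is metrically complete if every sequence of objects that is Cauchy for $d$ has an object $A$ as limit, i.e. $d(A_n,A)\to 0$. Let $\mathcal C$ be a small category with a strict coflow $T_\varepsilon$, and let $h:\mathcal C\to[\mathcal C^{op},\mathbf{Set}]$ be the Yoneda embedding, $h_A=\mathrm{Hom}(-,A)$. Then $h$ is full and faithful, and for every $\varepsilon\ge 0$ a pointwise left Kan extension $L_\varepsilon$ of $h\circ T_\varepsilon$ along $h$ exists. If $h$ is injective on objects (which holds under the usual convention that hom-sets are pairwise disjoint), the $L_\varepsilon$ can be chosen so that $L_\varepsilon\circ h=h\circ T_\varepsilon$, with the identity as unit of the Kan extension, and $L_0=\mathrm{Id}$. For every choice of pointwise left Kan extensions $L_\varepsilon$ with $L_\varepsilon\circ h=h\circ T_\varepsilon$ and the identity as unit: 1. the $L_\varepsilon$ are the functors of a coflow on $[\mathcal C^{op},\mathbf{Set}]$ such that 2. $h:(\mathcal C,T_\varepsilon)\to([\mathcal C^{op},\mathbf{Set}],L_\varepsilon)$ is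 a full, strict coflow-equivariant embedding, and 3. $([\mathcal C^{op},\mathbf{Set}],L_\varepsilon)$ is metrically complete. For an arbitrary choice of pointwise left Kan extensions $L_\varepsilon$, with units $\alpha_\varepsilon:h\circ T_\varepsilon\Rightarrow L_\varepsilon\circ h$, every $\alpha_\varepsilon$ is invertible and the same holds with the isomorphisms $\alpha_\varepsilon$ in place of the equalities $h\circ T_\varepsilon=L_\varepsilon\circ h$ in the definition of equivariance. -/

import Mathlib

open CategoryTheory
open scoped NNReal ENNReal

universe v u v' u'

/-- A coflow on a category `C` whose underlying family of endofunctors is `T`, indexed by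
`[0, ∞)`: the structure dual to a flow, that is, a flow on `Cᵒᵖ` with underlying family
`fun ε ↦ (T ε).op`, written out in `C`.  Here `T_ε T_δ` (first `T_δ`, then `T_ε`) is
`T δ ⋙ T ε`.  Where two indices agree only up to an equation of real numbers
(`0 + ε = ε` and the like), the identification of the two functors is the transition map
along the equation, which is the identity by `trans_refl`. -/
structure Coflow {C : Type u} [Category.{v} C] (T : ℝ≥0 → C ⥤ C) where
  /-- The transition `T_ε ⟶ T_δ` for `δ ≤ ε`. -/
  trans : ∀ {δ ε : ℝ≥0}, δ ≤ ε → (T ε ⟶ T δ)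
  trans_refl : ∀ ε : ℝ≥0, trans (le_refl ε) = 𝟙 (T ε)
  trans_comp : ∀ {δ ε ζ : ℝ≥0} (h₁ : δ ≤ ε) (h₂ : ε ≤ ζ),
    trans h₂ ≫ trans h₁ = trans (h₁.trans h₂)
  /-- The counit `T_0 ⟶ Id`. -/
  counit : T 0 ⟶ 𝟭 C
  /-- The comultiplication `T_{ε+δ} ⟶ T_ε T_δ`. -/
  comul : ∀ ε δ : ℝ≥0, T (ε + δ) ⟶ T δ ⋙ T ε
  comul_counit_left : ∀ (ε : ℝ≥0) (X : C),
    (comul 0 ε).app X ≫ counit.app ((T ε).obj X) = (trans (zero_add ε).ge).app X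
  comul_counit_right : ∀ (ε : ℝ≥0) (X : C),
    (comul ε 0).app X ≫ (T ε).map (counit.app X) = (trans (add_zero ε).ge).app X
  coassoc : ∀ (ε ζ δ : ℝ≥0) (X : C),
    (comul (ε + ζ) δ).app X ≫ (comul ε ζ).app ((T δ).obj X) =
      (trans (add_assoc ε ζ δ).ge).app X ≫ (comul ε (ζ + δ)).app X ≫
        (T ε).map ((comul ζ δ).app X)
  trans_comul : ∀ {ε δ ζ κ : ℝ≥0} (h₁ : ε ≤ δ) (h₂ : ζ ≤ κ) (X : C),
    (trans (add_le_add h₁ h₂)).app X ≫ (comul ε ζ).app X =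
      (comul δ κ).app X ≫ (trans h₁).app ((T κ).obj X) ≫ (T ε).map ((trans h₂).app X)

namespace Coflow

section

variable {C : Type u} [Category.{v} C] {T : ℝ≥0 → C ⥤ C}

/-- A coflow is strict if the counit `T_0 ⟶ Id` and the comultiplications
`T_{ε+δ} ⟶ T_ε T_δ` are identities (in particular their source and target are equal). -/
structure IsStrict (F : Coflow T) : Prop where
  counit_eq : ∃ h : T 0 = 𝟭 C, F.counit = eqToHom h
  comul_eq : ∀ ε δ : ℝ≥0, ∃ h : T (ε + δ) = T δ ⋙ T ε, F.comul ε δ = eqToHom h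

/-- Weak `ε`-interleavings in a category with a coflow (dual to those for a flow): maps
`T_ε B ⟶ A` and `T_ε A ⟶ B` such that both composites
`T_{2ε} A ⟶ T_ε T_ε A ⟶ T_ε B ⟶ A` and `T_{2ε} B ⟶ T_ε T_ε B ⟶ T_ε A ⟶ B` agree with
the maps `T_{2ε} ⟶ T_0 ⟶ Id`. -/
def WeaklyInterleaved (F : Coflow T) (ε : ℝ≥0) (A B : C) : Prop :=
  ∃ (α : (T ε).obj B ⟶ A) (β : (T ε).obj A ⟶ B),
    (F.comul ε ε).app A ≫ (T ε).map β ≫ α =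
      (F.trans (zero_le (a := ε + ε))).app A ≫ F.counit.app A ∧
    (F.comul ε ε).app B ≫ (T ε).map α ≫ β =
      (F.trans (zero_le (a := ε + ε))).app B ≫ F.counit.app B

/-- The interleaving distance, with value `∞` if there is no weak interleaving. -/
noncomputable def interleavingDist (F : Coflow T) (A B : C) : ℝ≥0∞ :=
  ⨅ (ε : ℝ≥0) (_ : F.WeaklyInterleaved ε A B), (ε : ℝ≥0∞)

/-- Cauchy sequences of objects. -/
def IsCauchy (F : Coflow T) (A : ℕ → C) : Prop :=
  ∀ ε : ℝ≥0, 0 < ε → ∃ N : ℕ, ∀ n m : ℕ, N ≤ n → N ≤ m → F.interleavingDist (A n) (A m) < ε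

/-- `B` is a metric limit of the sequence `A`. -/
def IsMetricLimit (F : Coflow T) (A : ℕ → C) (B : C) : Prop :=
  ∀ ε : ℝ≥0, 0 < ε → ∃ N : ℕ, ∀ n : ℕ, N < n → F.interleavingDist (A n) B < ε

/-- Every Cauchy sequence of objects has a metric limit. -/
def MetricallyComplete (F : Coflow T) : Prop :=
  ∀ A : ℕ → C, F.IsCauchy A → ∃ B : C, F.IsMetricLimit A B

end

section

variable {C : Type u} [Category.{v} C] {D : Type u'} [Category.{v'} D]
  {T : ℝ≥0 → C ⥤ C} {S : ℝ≥0 → D ⥤ D}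

/-- Compatibility of a functor `H : C ⥤ D` and comparison maps `θ_ε : H T_ε ⟶ S_ε H` with
coflows on `T` and on `S`: the squares for the counits, the transitions and the
comultiplications commute. -/
structure EquivariantVia (F : Coflow T) (G : Coflow S) (H : C ⥤ D)
    (θ : ∀ ε : ℝ≥0, T ε ⋙ H ⟶ H ⋙ S ε) : Prop where
  counit : ∀ X : C, (θ 0).app X ≫ G.counit.app (H.obj X) = H.map (F.counit.app X)
  trans : ∀ {δ ε : ℝ≥0} (h : δ ≤ ε) (X : C),
    (θ ε).app X ≫ (G.trans h).app (H.obj X) = H.map ((F.trans h).app X) ≫ (θ δ).app X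
  comul : ∀ (ε δ : ℝ≥0) (X : C),
    (θ (ε + δ)).app X ≫ (G.comul ε δ).app (H.obj X) =
      H.map ((F.comul ε δ).app X) ≫ (θ ε).app ((T δ).obj X) ≫ (S ε).map ((θ δ).app X)

/-- Strict coflow-equivariance of `H`: the functors `H T_ε` and `S_ε H` are equal, and the
three squares commute with these equalities as comparison maps. -/
def StrictEquivariant (F : Coflow T) (G : Coflow S) (H : C ⥤ D) : Prop :=
  ∃ h : ∀ ε : ℝ≥0, T ε ⋙ H = H ⋙ S ε, F.EquivariantVia G H (fun ε => eqToHom (h ε))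

end

end Coflow

/-- The pair `(L, α)`, with unit `α : h ∘ T ⟶ L ∘ h`, is a pointwise left Kan extension of
`h ∘ T` along the Yoneda embedding `h`. -/
def IsYonedaKanExtension {C : Type u} [SmallCategory C] (T : C ⥤ C)
    (L : (Cᵒᵖ ⥤ Type u) ⥤ (Cᵒᵖ ⥤ Type u)) (α : T ⋙ yoneda ⟶ yoneda ⋙ L) : Prop :=
  Nonempty (Functor.LeftExtension.mk L α).IsPointwiseLeftKanExtension

/-!
The argument separates into a statement about coflows on a general category and a statement
about Kan extensions.

*Completeness.* Let `S` be a coflow on `D` with invertible comultiplications such that every `S_ε`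
has a right adjoint `R_ε`, and let `D` have sequential limits; then `D` is metrically complete
(`Coflow.metricallyComplete_of_isLeftAdjoint`).  Call a map `S_t A ⟶ B` a morphism `A ⟶ B` of
degree `t`.  Such morphisms compose, degrees add, a degree may be raised along the transition maps,
and a weak `ε`-interleaving is a pair of morphisms of degree `ε` in opposite directions whose two
composites are identities raised to degree `2ε`.  By passing to a subsequence it suffices to
treat a sequence `B n` with interleavings `φ n : B n ⟶ B (n + 1)`, `ψ n : B (n + 1) ⟶ B n` of
summable degrees `r n`, with tail sums `s n`.  The limit object `A` is the limit of the
objects `R_{s n} (B n)` along the maps induced by `ψ`; the adjunctions and the inverses of the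
comultiplications show that it is a limit in the graded sense
(`Coflow.InterleavedSeq.IsGradedLimit`), with projections of degree `s n`.  The composites of
the maps `φ` give a map `B n ⟶ A` of degree `s n`, and together with the projection it is
an `s n`-interleaving (`Coflow.InterleavedSeq.IsGradedLimit.weaklyInterleaved`).

*Extension.* A natural transformation out of a left Kan extension along the Yoneda embedding is
determined by its restriction to representables and may be prescribed there.  So the structure
maps of a coflow on `C` extend to the functors `L_ε`, and the laws of a coflow need only be
checked on representables, where they are the laws in `C` (`Coflow.extend`).  The functors `L_ε` are
left adjoints, and the extended comultiplications are invertible because both their source and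
their target are cocontinuous extensions of isomorphic functors
(`Coflow.isIso_comul_extend`).
-/

namespace Coflow

/-! ### Morphisms with a degree -/

section Graded

variable {D : Type u} [Category.{v} D] {S : ℝ≥0 → D ⥤ D} (G : Coflow S)

/-- A morphism of degree `s` from `A` to `B` is a map `S_s A ⟶ B`; this is `f` regarded as a
morphism of the larger degree `t`. -/
def lift {s t : ℝ≥0} (h : s ≤ t) {A B : D} (f : (S s).obj A ⟶ B) : (S t).obj A ⟶ B :=
  (G.trans h).app A ≫ f

/-- The composite of a morphism `f : A ⟶ B` of degree `s` and a morphism `g : B ⟶ C` of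
degree `t`, regarded as a morphism of some degree `r ≥ t + s`.  Allowing this slack keeps
equations between real numbers out of the types. -/
def comp {s t r : ℝ≥0} (h : t + s ≤ r) {A B C : D} (f : (S s).obj A ⟶ B)
    (g : (S t).obj B ⟶ C) : (S r).obj A ⟶ C :=
  (G.trans h).app A ≫ (G.comul t s).app A ≫ (S t).map f ≫ g

/-- The identity of `A` as a morphism of degree `t`. -/
def shiftId (t : ℝ≥0) (A : D) : (S t).obj A ⟶ A :=
  (G.trans (zero_le (a := t))).app A ≫ G.counit.app A

lemma trans_app_trans_app {r s t : ℝ≥0} (h₁ : r ≤ s) (h₂ : s ≤ t) (A : D) :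
    (G.trans h₂).app A ≫ (G.trans h₁).app A = (G.trans (h₁.trans h₂)).app A := by
  rw [← NatTrans.comp_app, G.trans_comp]

lemma lift_shiftId {s t : ℝ≥0} (h : s ≤ t) (A : D) :
    G.lift h (G.shiftId s A) = G.shiftId t A := by
  simp only [lift, shiftId, reassoc_of% trans_app_trans_app]

lemma lift_comp {s t r q : ℝ≥0} (h : t + s ≤ r) (h' : r ≤ q) {A B C : D}
    (f : (S s).obj A ⟶ B) (g : (S t).obj B ⟶ C) :
    G.lift h' (G.comp h f g) = G.comp (h.trans h') f g := by
  simp only [lift, comp, reassoc_of% trans_app_trans_app]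

lemma trans_comul_left {t s s' : ℝ≥0} (h : s ≤ s') (A : D) :
    (G.comul t s').app A ≫ (S t).map ((G.trans h).app A) =
      (G.trans (add_le_add le_rfl h)).app A ≫ (G.comul t s).app A := by
  rw [G.trans_comul (le_refl t) h, G.trans_refl]
  exact congrArg (_ ≫ ·) (Category.id_comp _).symm

lemma trans_comul_right {t t' s : ℝ≥0} (h : t ≤ t') (A : D) :
    (G.comul t' s).app A ≫ (G.trans h).app ((S s).obj A) =
      (G.trans (add_le_add h le_rfl)).app A ≫ (G.comul t s).app A := by
  rw [G.trans_comul h (le_refl s), G.trans_refl, NatTrans.id_app]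
  exact congrArg (_ ≫ ·) ((congrArg (_ ≫ ·) ((S t).map_id _)).trans (Category.comp_id _)).symm

lemma comp_lift_left {s s' t r : ℝ≥0} (hs : s ≤ s') (h : t + s' ≤ r) {A B C : D}
    (f : (S s).obj A ⟶ B) (g : (S t).obj B ⟶ C) :
    G.comp h (G.lift hs f) g = G.comp ((add_le_add le_rfl hs).trans h) f g := by
  simp only [comp, lift, Functor.map_comp, Category.assoc, reassoc_of% trans_comul_left,
    reassoc_of% trans_app_trans_app]

lemma comp_lift_right {s t t' r : ℝ≥0} (ht : t ≤ t') (h : t' + s ≤ r) {A B C : D}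
    (f : (S s).obj A ⟶ B) (g : (S t).obj B ⟶ C) :
    G.comp h f (G.lift ht g) = G.comp ((add_le_add ht le_rfl).trans h) f g := by
  simp only [comp, lift]
  rw [NatTrans.naturality_assoc, reassoc_of% trans_comul_right, reassoc_of% trans_app_trans_app]

lemma comp_shiftId {s t r : ℝ≥0} (h : t + s ≤ r) {A B : D} (f : (S s).obj A ⟶ B) :
    G.comp h f (G.shiftId t B) = G.lift (le_add_self.trans h) f := by
  have : G.shiftId t B = G.lift zero_le (G.shiftId 0 B) := (G.lift_shiftId _ B).symm
  rw [this, comp_lift_right]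
  simp only [comp, shiftId, lift, G.trans_refl, NatTrans.id_app, Category.id_comp]
  rw [G.counit.naturality, reassoc_of% G.comul_counit_left, reassoc_of% trans_app_trans_app]
  rfl

lemma shiftId_comp {s t r : ℝ≥0} (h : t + s ≤ r) {A B : D} (f : (S t).obj A ⟶ B) :
    G.comp h (G.shiftId s A) f = G.lift (le_self_add.trans h) f := by
  have : G.shiftId s A = G.lift zero_le (G.shiftId 0 A) := (G.lift_shiftId _ A).symm
  rw [this, comp_lift_left]
  simp only [comp, shiftId, lift, G.trans_refl, NatTrans.id_app, Category.id_comp]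
  rw [reassoc_of% G.comul_counit_right, reassoc_of% trans_app_trans_app]

lemma comp_assoc {a b c p q r : ℝ≥0} (h₁ : b + a ≤ p) (h₂ : c + p ≤ r) (h₃ : c + b ≤ q)
    (h₄ : q + a ≤ r) {W X Y Z : D} (f : (S a).obj W ⟶ X) (g : (S b).obj X ⟶ Y)
    (k : (S c).obj Y ⟶ Z) :
    G.comp h₂ (G.comp h₁ f g) k = G.comp h₄ f (G.comp h₃ g k) := by
  simp only [comp, Functor.map_comp, Category.assoc]
  rw [reassoc_of% trans_comul_left, NatTrans.naturality_assoc, reassoc_of% trans_comul_right,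
    reassoc_of% trans_app_trans_app, reassoc_of% trans_app_trans_app]
  have := (G.comul c b).naturality_assoc f ((S c).map g ≫ k)
  rw [this, reassoc_of% G.coassoc, reassoc_of% trans_app_trans_app]
  rfl

/-! ### The interleaving distance -/

lemma weaklyInterleaved_iff {ε : ℝ≥0} {A B : D} :
    G.WeaklyInterleaved ε A B ↔ ∃ (α : (S ε).obj B ⟶ A) (β : (S ε).obj A ⟶ B),
      G.comp le_rfl β α = G.shiftId (ε + ε) A ∧ G.comp le_rfl α β = G.shiftId (ε + ε) B := by
  simp only [WeaklyInterleaved, comp, shiftId, G.trans_refl, NatTrans.id_app, Category.id_comp]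

variable {G}

lemma WeaklyInterleaved.mono {ε δ : ℝ≥0} {A B : D} (h : G.WeaklyInterleaved ε A B)
    (hle : ε ≤ δ) : G.WeaklyInterleaved δ A B := by
  rw [weaklyInterleaved_iff] at h ⊢
  obtain ⟨α, β, h₁, h₂⟩ := h
  refine ⟨G.lift hle α, G.lift hle β, ?_, ?_⟩
  · rw [comp_lift_left, comp_lift_right, ← G.lift_comp le_rfl (add_le_add hle hle), h₁,
      lift_shiftId]
  · rw [comp_lift_left, comp_lift_right, ← G.lift_comp le_rfl (add_le_add hle hle), h₂,
      lift_shiftId]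

/-- The round trip of a composite of two interleavings. -/
lemma comp_comp_comp_eq_shiftId {a b p q : ℝ≥0} {A B C : D} {f : (S a).obj A ⟶ B}
    {f' : (S a).obj B ⟶ A} {g : (S b).obj B ⟶ C} {g' : (S b).obj C ⟶ B}
    (h : G.comp le_rfl f f' = G.shiftId (a + a) A) (k : G.comp le_rfl g g' = G.shiftId (b + b) B)
    (hp : b + a ≤ p) (hq : a + b ≤ p) (hr : p + p ≤ q) :
    G.comp hr (G.comp hp f g) (G.comp hq g' f') = G.shiftId q A := by
  have h₁ : (p + b) + a ≤ q := by rw [add_assoc]; exact (add_le_add le_rfl hp).trans hr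
  have h₂ : p + b ≤ p + b := le_rfl
  have h₃ : a + (b + b) ≤ p + b := by rw [← add_assoc]; exact add_le_add hq le_rfl
  have h₄ : a + a ≤ q := by linarith
  rw [G.comp_assoc hp hr h₂ h₁, ← G.comp_assoc le_rfl h₃ hq h₂, k,
    shiftId_comp, comp_lift_right, ← G.lift_comp le_rfl h₄, h, lift_shiftId]

lemma WeaklyInterleaved.trans {ε δ : ℝ≥0} {A B C : D} (h : G.WeaklyInterleaved ε A B)
    (k : G.WeaklyInterleaved δ B C) : G.WeaklyInterleaved (ε + δ) A C := by
  rw [weaklyInterleaved_iff] at h k ⊢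
  obtain ⟨α, β, h₁, h₂⟩ := h
  obtain ⟨α', β', k₁, k₂⟩ := k
  exact ⟨G.comp le_rfl α' α, G.comp (add_comm _ _).le β β',
    comp_comp_comp_eq_shiftId h₁ k₁ _ _ _, comp_comp_comp_eq_shiftId k₂ h₂ _ _ _⟩

end Graded

section Complete

variable {D : Type u} [Category.{v} D] {S : ℝ≥0 → D ⥤ D} (G : Coflow S)

/-! ### Limits of sequences of interleaved objects -/

/-- A sequence of objects with chosen interleavings between neighbours: `B n` and `B (n + 1)`
are `r n`-interleaved by `φ n` and `ψ n`.  The number `s n` stands for the sum of all `r k` with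
`k ≥ n`; only the recursion `r n + s (n + 1) = s n` is used. -/
structure InterleavedSeq where
  /-- The objects. -/
  B : ℕ → D
  /-- The degrees of the interleavings. -/
  r : ℕ → ℝ≥0
  /-- The tail sums of the degrees. -/
  s : ℕ → ℝ≥0
  /-- The forward maps. -/
  φ : ∀ n, (S (r n)).obj (B n) ⟶ B (n + 1)
  /-- The backward maps. -/
  ψ : ∀ n, (S (r n)).obj (B (n + 1)) ⟶ B n
  s_eq : ∀ n, r n + s (n + 1) = s n
  φ_ψ : ∀ n, G.comp le_rfl (φ n) (ψ n) = G.shiftId (r n + r n) (B n)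
  ψ_φ : ∀ n, G.comp le_rfl (ψ n) (φ n) = G.shiftId (r n + r n) (B (n + 1))

variable {G}

/-- The sequence without its first object. -/
def InterleavedSeq.tail (Q : G.InterleavedSeq) : G.InterleavedSeq where
  B n := Q.B (n + 1)
  r n := Q.r (n + 1)
  s n := Q.s (n + 1)
  φ n := Q.φ (n + 1)
  ψ n := Q.ψ (n + 1)
  s_eq n := Q.s_eq (n + 1)
  φ_ψ n := Q.φ_ψ (n + 1)
  ψ_φ n := Q.ψ_φ (n + 1)

/-- The object `A` with the projections `π n : A ⟶ B n` of degree `s n` is the limit of the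
backward maps `ψ n` in the graded sense: the morphisms `X ⟶ A` of each degree `t` correspond to
the compatible families of morphisms `X ⟶ B n` of degree `s n + t`. -/
structure InterleavedSeq.IsGradedLimit (Q : G.InterleavedSeq) (A : D)
    (π : ∀ n, (S (Q.s n)).obj A ⟶ Q.B n) : Prop where
  comp_ψ : ∀ n, G.comp (Q.s_eq n).le (π (n + 1)) (Q.ψ n) = π n
  exists_lift : ∀ (t : ℝ≥0) (X : D) (f : ∀ n, (S (Q.s n + t)).obj X ⟶ Q.B n),
    (∀ n, G.comp (by rw [← Q.s_eq n, add_assoc]) (f (n + 1)) (Q.ψ n) = f n) →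
      ∃ g : (S t).obj X ⟶ A, ∀ n, G.comp le_rfl g (π n) = f n
  hom_ext : ∀ (t : ℝ≥0) (X : D) (g g' : (S t).obj X ⟶ A),
    (∀ n, G.comp le_rfl g (π n) = G.comp le_rfl g' (π n)) → g = g'

/-- Dropping the first object does not change the limit. -/
lemma InterleavedSeq.IsGradedLimit.tail {Q : G.InterleavedSeq} {A : D}
    {π : ∀ n, (S (Q.s n)).obj A ⟶ Q.B n} (h : Q.IsGradedLimit A π) :
    Q.tail.IsGradedLimit A (fun n => π (n + 1)) where
  comp_ψ n := h.comp_ψ (n + 1)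
  exists_lift t X f hf := by
    -- a compatible family on the tail extends to the first object along `ψ 0`
    obtain ⟨g, hg⟩ := h.exists_lift t X
      (fun | 0 => G.comp (by rw [← Q.s_eq 0, add_assoc]; rfl) (f 0) (Q.ψ 0) | n + 1 => f n)
      (fun | 0 => rfl | n + 1 => hf n)
    exact ⟨g, fun n => hg (n + 1)⟩
  hom_ext t X g g' hg := by
    refine h.hom_ext t X g g' fun n => ?_
    have e : Q.r n + (Q.s (n + 1) + t) ≤ Q.s n + t := by rw [← Q.s_eq n, add_assoc]
    rw [← h.comp_ψ n, ← G.comp_assoc le_rfl e, ← G.comp_assoc le_rfl e]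
    exact congrArg (fun k => G.comp e k (Q.ψ n)) (hg n)

/-- The sum of the first `n` degrees. -/
def InterleavedSeq.p (Q : G.InterleavedSeq) : ℕ → ℝ≥0
  | 0 => 0
  | n + 1 => Q.r n + Q.p n

lemma InterleavedSeq.p_succ (Q : G.InterleavedSeq) (n : ℕ) : Q.p (n + 1) = Q.r n + Q.p n := rfl

lemma InterleavedSeq.p_add_s (Q : G.InterleavedSeq) (n : ℕ) : Q.p n + Q.s n = Q.s 0 := by
  induction n with
  | zero => simp [p]
  | succ n ih => rw [← ih, ← Q.s_eq n, p]; ring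

/-- The composite `B 0 ⟶ B n` of the forward maps, of degree `p n`. -/
def InterleavedSeq.Φ (Q : G.InterleavedSeq) : ∀ n, (S (Q.p n)).obj (Q.B 0) ⟶ Q.B n
  | 0 => G.shiftId 0 _
  | n + 1 => G.comp (Q.p_succ n).ge (Q.Φ n) (Q.φ n)

lemma InterleavedSeq.comp_Φ_ψ (Q : G.InterleavedSeq) (n : ℕ) {q : ℝ≥0}
    (h : Q.r n + Q.p (n + 1) ≤ q) :
    G.comp h (Q.Φ (n + 1)) (Q.ψ n) =
      G.lift (le_add_self.trans ((add_le_add le_rfl le_add_self).trans h)) (Q.Φ n) := by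
  rw [Φ, G.comp_assoc _ h le_rfl (by rw [add_assoc]; exact h), Q.φ_ψ, comp_shiftId]

/-- Going from the limit to `B 0` and on to `B n` is, up to degree, the projection to `B n`. -/
lemma InterleavedSeq.IsGradedLimit.comp_Φ {Q : G.InterleavedSeq} {A : D}
    {π : ∀ n, (S (Q.s n)).obj A ⟶ Q.B n} (h : Q.IsGradedLimit A π) (n : ℕ) {q : ℝ≥0}
    (hq : Q.p n + Q.s 0 ≤ q) (hq' : Q.s n ≤ q) :
    G.comp hq (π 0) (Q.Φ n) = G.lift hq' (π n) := by
  induction n generalizing q with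
  | zero => exact G.comp_shiftId _ _
  | succ n ih =>
    have e₁ := Q.p_add_s n
    have e₂ := Q.s_eq n
    have hq₁ : Q.r n + Q.p n + Q.s 0 ≤ q := hq
    have e₃ : Q.s n ≤ Q.p n + Q.s 0 := by
      rw [← e₁]; exact le_add_self.trans le_add_self
    have e₄ : Q.r n + Q.s n ≤ q :=
      (add_le_add le_rfl e₃).trans (by rw [← add_assoc]; exact hq₁)
    rw [Φ, ← G.comp_assoc (le_refl _) (by rw [← add_assoc]; exact hq₁) _ hq, ih le_rfl e₃,
      comp_lift_left]
    conv_lhs => rw [← h.comp_ψ n]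
    rw [G.comp_assoc _ e₄ le_rfl (by rw [add_assoc, e₂]; exact e₄), Q.ψ_φ, comp_shiftId]

/-- The projection to `B 0` and the map `B 0 ⟶ A` induced by the composites `Φ n` form an
interleaving: each round trip may be computed on the components of the limit. -/
lemma InterleavedSeq.IsGradedLimit.weaklyInterleaved_zero {Q : G.InterleavedSeq} {A : D}
    {π : ∀ n, (S (Q.s n)).obj A ⟶ Q.B n} (h : Q.IsGradedLimit A π) :
    G.WeaklyInterleaved (Q.s 0) (Q.B 0) A := by
  have hp (n : ℕ) : Q.p n ≤ Q.s n + Q.s 0 := by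
    rw [← Q.p_add_s n]; exact le_self_add.trans le_add_self
  obtain ⟨g, hg⟩ := h.exists_lift (Q.s 0) (Q.B 0) (fun n => G.lift (hp n) (Q.Φ n)) (by
    intro n
    rw [comp_lift_left, comp_Φ_ψ])
  rw [weaklyInterleaved_iff]
  refine ⟨π 0, g, ?_, h.hom_ext _ _ _ _ fun n => ?_⟩
  · rw [hg 0]
    exact G.lift_shiftId _ _
  · have e : Q.p n + Q.s 0 ≤ Q.s n + (Q.s 0 + Q.s 0) := by
      rw [← add_assoc]; exact add_le_add (hp n) le_rfl
    rw [G.comp_assoc le_rfl le_rfl (le_refl _) (by rw [add_assoc]), hg, comp_lift_right,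
      shiftId_comp, h.comp_Φ]

lemma InterleavedSeq.IsGradedLimit.weaklyInterleaved {Q : G.InterleavedSeq} {A : D}
    {π : ∀ n, (S (Q.s n)).obj A ⟶ Q.B n} (h : Q.IsGradedLimit A π) (n : ℕ) :
    G.WeaklyInterleaved (Q.s n) (Q.B n) A := by
  induction n generalizing Q with
  | zero => exact h.weaklyInterleaved_zero
  | succ n ih => exact ih h.tail

/-! ### Metric completeness -/

lemma interleavingDist_lt_iff {A B : D} {x : ℝ≥0∞} :
    G.interleavingDist A B < x ↔ ∃ ε : ℝ≥0, G.WeaklyInterleaved ε A B ∧ (ε : ℝ≥0∞) < x := by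
  simp only [interleavingDist, iInf_lt_iff, exists_prop]

variable (G) in
/-- The standard reduction: it suffices to find limits of rapidly converging sequences. -/
theorem metricallyComplete_of_exists_isGradedLimit
    (H : ∀ Q : G.InterleavedSeq, ∃ A π, Q.IsGradedLimit A π) : G.MetricallyComplete := by
  intro A hA
  -- `e n = 2⁻ⁿ` is both the distance bound between neighbours and the tail sum of these bounds
  let e : ℕ → ℝ≥0 := fun n => (1 / 2) ^ n
  have he (n : ℕ) : e (n + 1) + e (n + 1) = e n := by
    simp only [e, pow_succ, ← mul_add, add_halves, mul_one]
  have he0 (n : ℕ) : 0 < e n := by positivity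
  choose N hN using fun n => hA (e (n + 1)) (he0 _)
  -- indices of the subsequence; sums rather than `N` itself, so that `N n ≤ k (n + 1)` as well
  let k : ℕ → ℕ := fun n => ∑ i ∈ Finset.range (n + 1), N i
  have hk (n m : ℕ) (h : n ≤ m) : N n ≤ k m :=
    Finset.single_le_sum (fun _ _ => Nat.zero_le _) (Finset.mem_range.2 (by omega))
  have hI (n : ℕ) {a b : ℕ} (ha : N n ≤ a) (hb : N n ≤ b) :
      G.WeaklyInterleaved (e (n + 1)) (A a) (A b) := by
    obtain ⟨ε, h, hε⟩ := interleavingDist_lt_iff.1 (hN n a b ha hb)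
    exact h.mono (ENNReal.coe_lt_coe.1 hε).le
  choose ψ φ h₁ h₂ using fun n =>
    G.weaklyInterleaved_iff.1 (hI n (hk n n le_rfl) (hk n (n + 1) (Nat.le_succ n)))
  let Q : G.InterleavedSeq := ⟨fun n => A (k n), fun n => e (n + 1), e, φ, ψ, he, h₁, h₂⟩
  obtain ⟨B, π, hB⟩ := H Q
  refine ⟨B, fun ε hε => ?_⟩
  obtain ⟨n, hn⟩ := NNReal.exists_pow_lt_of_lt_one (half_pos hε) (one_half_lt_one (α := ℝ≥0))
  refine ⟨N n, fun m hm => interleavingDist_lt_iff.2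
    ⟨_, (hI n hm.le (hk n n le_rfl)).trans (hB.weaklyInterleaved n), ENNReal.coe_lt_coe.2 ?_⟩⟩
  change e (n + 1) + e n < ε
  have h₃ : e n < ε / 2 := hn
  calc e (n + 1) + e n ≤ e n + e n := by rw [← he n]; gcongr; exact le_self_add
    _ < ε / 2 + ε / 2 := add_lt_add h₃ h₃
    _ = ε := add_halves ε

open Limits

/-- The computation behind the graded limits, for one object: through a right adjoint `R` of `S_s`
and the comultiplication, morphisms `X ⟶ R B` of degree `t` become morphisms `X ⟶ B` of
degree `s + t`, by composition with the counit `R B ⟶ B` of degree `s`. -/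
lemma comp_counit {s t : ℝ≥0} {R : D ⥤ D} (adj : S s ⊣ R) {X B : D}
    (g : (S t).obj X ⟶ R.obj B) :
    G.comp (le_refl (s + t)) g (adj.counit.app B) =
      (G.comul s t).app X ≫ (adj.homEquiv _ _).symm g := by
  rw [comp, G.trans_refl, NatTrans.id_app, Category.id_comp, Adjunction.homEquiv_counit]

lemma comp_counit_injective (hG : ∀ ε δ, IsIso (G.comul ε δ)) {s t : ℝ≥0} {R : D ⥤ D}
    (adj : S s ⊣ R) {X B : D} {g g' : (S t).obj X ⟶ R.obj B}
    (h : G.comp (le_refl (s + t)) g (adj.counit.app B) =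
      G.comp (le_refl (s + t)) g' (adj.counit.app B)) : g = g' := by
  have := hG s t
  rw [comp_counit, comp_counit, cancel_epi] at h
  exact (adj.homEquiv _ _).symm.injective h

lemma exists_comp_counit (hG : ∀ ε δ, IsIso (G.comul ε δ)) {s t : ℝ≥0} {R : D ⥤ D}
    (adj : S s ⊣ R) {X B : D} (f : (S (s + t)).obj X ⟶ B) :
    ∃ g : (S t).obj X ⟶ R.obj B, G.comp (le_refl (s + t)) g (adj.counit.app B) = f := by
  have := hG s t
  refine ⟨adj.homEquiv _ _ (inv ((G.comul s t).app X) ≫ f), ?_⟩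
  rw [comp_counit, Equiv.symm_apply_apply, IsIso.hom_inv_id_assoc]

lemma comp_precomp {s t q : ℝ≥0} (h : t + s ≤ q) {X A B C : D} (f : (S s).obj X ⟶ A) (k : A ⟶ B)
    (g : (S t).obj B ⟶ C) : G.comp h (f ≫ k) g = G.comp h f ((S t).map k ≫ g) := by
  simp only [comp, Functor.map_comp, Category.assoc]

variable (G) in
/-- A coflow with invertible comultiplications whose functors have right adjoints, on a category
with sequential limits, is metrically complete.  The limit of an interleaved sequence is the
limit of the objects `R_{s n} (B n)`, where `R_ε` is right adjoint to `S_ε`. -/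
theorem metricallyComplete_of_isLeftAdjoint [HasLimitsOfShape ℕᵒᵖ D]
    (hS : ∀ ε, (S ε).IsLeftAdjoint) (hG : ∀ ε δ, IsIso (G.comul ε δ)) :
    G.MetricallyComplete := by
  refine G.metricallyComplete_of_exists_isGradedLimit fun Q => ?_
  let adj (n : ℕ) := Adjunction.ofIsLeftAdjoint (S (Q.s n))
  let R (n : ℕ) : D := (S (Q.s n)).rightAdjoint.obj (Q.B n)
  let ev (n : ℕ) : (S (Q.s n)).obj (R n) ⟶ Q.B n := (adj n).counit.app (Q.B n)
  -- the map of degree zero that corresponds to `ψ n` under the adjunctions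
  let q (n : ℕ) : R (n + 1) ⟶ R n :=
    (adj n).homEquiv _ _ (G.comp (Q.s_eq n).le (ev (n + 1)) (Q.ψ n))
  have hq (n : ℕ) : (S (Q.s n)).map (q n) ≫ ev n =
      G.comp (Q.s_eq n).le (ev (n + 1)) (Q.ψ n) := by
    rw [← Adjunction.homEquiv_counit, Equiv.symm_apply_apply]
  let P : ℕᵒᵖ ⥤ D := Functor.ofOpSequence q
  let pr (n : ℕ) : limit P ⟶ R n := limit.π P ⟨n⟩
  have hpr (n : ℕ) : pr (n + 1) ≫ q n = pr n := by
    have := limit.w P (homOfLE (Nat.le_succ n)).op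
    rwa [Functor.ofOpSequence_map_homOfLE_succ] at this
  -- composition with the counits turns composition with `q n` into composition with `ψ n`
  have hstep {X : D} {t : ℝ≥0} (n : ℕ) (g : (S t).obj X ⟶ R (n + 1)) :
      G.comp (le_refl (Q.s n + t)) (g ≫ q n) (ev n) =
        G.comp (by rw [← Q.s_eq n, add_assoc]) (G.comp (le_refl (Q.s (n + 1) + t)) g (ev (n + 1)))
          (Q.ψ n) := by
    rw [comp_precomp, hq]
    exact (G.comp_assoc _ _ _ _ _ _ _).symm
  refine ⟨limit P, fun n => (S (Q.s n)).map (pr n) ≫ ev n, ?_, ?_, ?_⟩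
  · intro n
    rw [← hpr n, Functor.map_comp, Category.assoc, hq]
    simp only [comp, Functor.map_comp, Category.assoc, NatTrans.naturality_assoc]
    rfl
  · intro t X f hf
    choose g hg using fun n => exists_comp_counit hG (adj n) (f n)
    have hgq (n : ℕ) : g (n + 1) ≫ q n = g n := by
      refine comp_counit_injective hG (adj n) ?_
      rw [hg n, ← hf n, ← hg (n + 1)]
      exact hstep n _
    let c : Cone P := ⟨(S t).obj X, NatTrans.ofOpSequence (fun n => g n) (by
      intro n
      rw [Functor.ofOpSequence_map_homOfLE_succ]
      exact (Category.id_comp _).trans (hgq n).symm)⟩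
    refine ⟨limit.lift P c, fun n => ?_⟩
    rw [← comp_precomp, show limit.lift P c ≫ pr n = g n from limit.lift_π c ⟨n⟩]
    exact hg n
  · intro t X g g' h
    refine limit.hom_ext fun ⟨n⟩ => comp_counit_injective hG (adj n) ?_
    have := h n
    rw [← comp_precomp, ← comp_precomp] at this
    exact this

end Complete
end Coflow

/-! ### Kan extensions along the Yoneda embedding -/

section Yoneda

open Limits Functor

variable {C : Type u} [SmallCategory C]

/-- The passage from `yoneda` to the isomorphic functor `uliftYoneda`, for which Mathlib has the
characterization of left Kan extensions and the adjunction. -/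
lemma isLeftKanExtension_yoneda_iff_uliftYoneda {A : C ⥤ Cᵒᵖ ⥤ Type u}
    {L : (Cᵒᵖ ⥤ Type u) ⥤ (Cᵒᵖ ⥤ Type u)} (α : A ⟶ yoneda ⋙ L) :
    L.IsLeftKanExtension α ↔ L.IsLeftKanExtension
      (α ≫ whiskerRight (uliftYonedaIsoYoneda.{u} (C := C)).inv L) := by
  let e : uliftYoneda.{u} ⋙ 𝟭 (Cᵒᵖ ⥤ Type u) ≅ yoneda :=
    Functor.rightUnitor _ ≪≫ (uliftYonedaIsoYoneda.{u} (C := C))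
  rw [Functor.isLeftKanExtension_iff_postcomp₁ (𝟭 _) e]
  refine Functor.isLeftKanExtension_iff_of_iso₂ _ _ (Iso.refl _) L.leftUnitor ?_
  ext X : 2
  simp [e]

/-- Left Kan extensions along the Yoneda embedding are the extensions which preserve colimits. -/
lemma isLeftKanExtension_yoneda_iff {A : C ⥤ Cᵒᵖ ⥤ Type u}
    {L : (Cᵒᵖ ⥤ Type u) ⥤ (Cᵒᵖ ⥤ Type u)} (α : A ⟶ yoneda ⋙ L) :
    L.IsLeftKanExtension α ↔ IsIso α ∧ PreservesColimitsOfSize.{u, u} L := by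
  rw [isLeftKanExtension_yoneda_iff_uliftYoneda,
    Presheaf.isLeftKanExtension_along_uliftYoneda_iff.{u, u, u, u, u + 1}, isIso_comp_right_iff]

lemma isLeftAdjoint_of_isLeftKanExtension_yoneda {A : C ⥤ Cᵒᵖ ⥤ Type u}
    {L : (Cᵒᵖ ⥤ Type u) ⥤ (Cᵒᵖ ⥤ Type u)} (α : A ⟶ yoneda ⋙ L) [h : L.IsLeftKanExtension α] :
    L.IsLeftAdjoint := by
  rw [isLeftKanExtension_yoneda_iff_uliftYoneda] at h
  exact (Presheaf.uliftYonedaAdjunction.{u, u, u, u, u + 1} L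
    (α ≫ whiskerRight (uliftYonedaIsoYoneda.{u} (C := C)).inv L)).isLeftAdjoint

end Yoneda

/-! ### Extension of a coflow to presheaves -/

section Extend

variable {C : Type u} [SmallCategory C] {T : ℝ≥0 → C ⥤ C} (F : Coflow T)
  {L : ℝ≥0 → (Cᵒᵖ ⥤ Type u) ⥤ (Cᵒᵖ ⥤ Type u)} (α : ∀ ε, T ε ⋙ yoneda ⟶ yoneda ⋙ L ε)

/-- Natural transformations out of a left Kan extension along the Yoneda embedding agree if
they agree on representable presheaves. -/
lemma app_eq_of_app_yoneda_eq {A : C ⥤ Cᵒᵖ ⥤ Type u} {K M : (Cᵒᵖ ⥤ Type u) ⥤ (Cᵒᵖ ⥤ Type u)}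
    (β : A ⟶ yoneda ⋙ K) [K.IsLeftKanExtension β] (γ₁ γ₂ : K ⟶ M)
    (h : ∀ X : C, β.app X ≫ γ₁.app (yoneda.obj X) = β.app X ≫ γ₂.app (yoneda.obj X))
    (P : Cᵒᵖ ⥤ Type u) : γ₁.app P = γ₂.app P := by
  have : γ₁ = γ₂ := K.hom_ext_of_isLeftKanExtension β γ₁ γ₂ (by ext1; ext1 X; exact h X)
  rw [this]

namespace Coflow

/-- The component `h (T_ε X) ⟶ L_ε (h X)` of the unit, with its source and target in
applied form. -/
def unitApp (ε : ℝ≥0) (X : C) : yoneda.obj ((T ε).obj X) ⟶ (L ε).obj (yoneda.obj X) :=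
  (α ε).app X

lemma unitApp_naturality (ε : ℝ≥0) {X Y : C} (f : X ⟶ Y) :
    unitApp α ε X ≫ (L ε).map (yoneda.map f) = yoneda.map ((T ε).map f) ≫ unitApp α ε Y :=
  ((α ε).naturality f).symm

/-- The comparison map `h T_ε T_δ ⟶ L_ε L_δ h` built from the units. -/
def unitComp (ε δ : ℝ≥0) : (T δ ⋙ T ε) ⋙ yoneda ⟶ yoneda ⋙ L δ ⋙ L ε :=
  (Functor.associator _ _ _).hom ≫ Functor.whiskerLeft (T δ) (α ε) ≫
    (Functor.associator _ _ _).inv ≫ Functor.whiskerRight (α δ) (L ε) ≫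
    (Functor.associator _ _ _).hom

variable [∀ ε, (L ε).IsLeftKanExtension (α ε)]

/-- The extension of the transition maps to presheaves. -/
noncomputable def extendTrans {δ ε : ℝ≥0} (h : δ ≤ ε) : L ε ⟶ L δ :=
  (L ε).descOfIsLeftKanExtension (α ε) _ (Functor.whiskerRight (F.trans h) yoneda ≫ α δ)

/-- The extension of the counit to presheaves. -/
noncomputable def extendCounit : L 0 ⟶ 𝟭 (Cᵒᵖ ⥤ Type u) :=
  (L 0).descOfIsLeftKanExtension (α 0) _ (Functor.whiskerRight F.counit yoneda ≫
    (Functor.leftUnitor _).hom ≫ (Functor.rightUnitor _).inv)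

/-- The extension of the comultiplications to presheaves. -/
noncomputable def extendComul (ε δ : ℝ≥0) : L (ε + δ) ⟶ L δ ⋙ L ε :=
  (L (ε + δ)).descOfIsLeftKanExtension (α (ε + δ)) _
    (Functor.whiskerRight (F.comul ε δ) yoneda ≫ unitComp α ε δ)

lemma unitApp_extendTrans {δ ε : ℝ≥0} (h : δ ≤ ε) (X : C) :
    unitApp α ε X ≫ (F.extendTrans α h).app (yoneda.obj X) =
      yoneda.map ((F.trans h).app X) ≫ unitApp α δ X :=
  (L ε).descOfIsLeftKanExtension_fac_app (α ε) _
    (Functor.whiskerRight (F.trans h) yoneda ≫ α δ) X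

lemma unitApp_extendCounit (X : C) :
    unitApp α 0 X ≫ (F.extendCounit α).app (yoneda.obj X) = yoneda.map (F.counit.app X) := by
  refine ((L 0).descOfIsLeftKanExtension_fac_app (α 0) _ _ X).trans ?_
  simp

lemma unitApp_extendComul (ε δ : ℝ≥0) (X : C) :
    unitApp α (ε + δ) X ≫ (F.extendComul α ε δ).app (yoneda.obj X) =
      yoneda.map ((F.comul ε δ).app X) ≫ unitApp α ε ((T δ).obj X) ≫
        (L ε).map (unitApp α δ X) := by
  refine ((L (ε + δ)).descOfIsLeftKanExtension_fac_app (α (ε + δ)) _ _ X).trans ?_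
  simp [unitComp, unitApp]

lemma extendCounit_naturality {P Q : Cᵒᵖ ⥤ Type u} (f : P ⟶ Q) :
    (L 0).map f ≫ (F.extendCounit α).app Q = (F.extendCounit α).app P ≫ f :=
  (F.extendCounit α).naturality f

lemma extendComul_naturality (ε δ : ℝ≥0) {P Q : Cᵒᵖ ⥤ Type u} (f : P ⟶ Q) :
    (L (ε + δ)).map f ≫ (F.extendComul α ε δ).app Q =
      (F.extendComul α ε δ).app P ≫ (L ε).map ((L δ).map f) :=
  (F.extendComul α ε δ).naturality f

/-- The coflow on presheaves extending a coflow on a small category along the Yoneda embedding.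
Every law is an equation between natural transformations out of a left Kan extension, hence may
be checked on representables. -/
noncomputable def extend : Coflow L where
  trans := F.extendTrans α
  trans_refl ε := by
    ext1; ext1 P
    refine app_eq_of_app_yoneda_eq (α ε) (F.extendTrans α (le_refl ε)) (𝟙 _) (fun X => ?_) P
    change unitApp α ε X ≫ _ = unitApp α ε X ≫ 𝟙 _
    rw [unitApp_extendTrans, F.trans_refl, NatTrans.id_app, CategoryTheory.Functor.map_id,
      Category.id_comp, Category.comp_id]
  trans_comp {δ ε ζ} h₁ h₂ := by
    ext1; ext1 P
    refine app_eq_of_app_yoneda_eq (α ζ) (F.extendTrans α h₂ ≫ F.extendTrans α h₁)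
      (F.extendTrans α (h₁.trans h₂)) (fun X => ?_) P
    change unitApp α ζ X ≫ _ ≫ _ = unitApp α ζ X ≫ _
    rw [reassoc_of% unitApp_extendTrans, unitApp_extendTrans, unitApp_extendTrans,
      ← Functor.map_comp_assoc, trans_app_trans_app]
  counit := F.extendCounit α
  comul := F.extendComul α
  comul_counit_left ε P := by
    refine app_eq_of_app_yoneda_eq (α (0 + ε))
      (F.extendComul α 0 ε ≫ Functor.whiskerLeft (L ε) (F.extendCounit α))
      (F.extendTrans α (zero_add ε).ge) (fun X => ?_) P
    change unitApp α (0 + ε) X ≫ (F.extendComul α 0 ε).app _ ≫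
      (F.extendCounit α).app ((L ε).obj _) = unitApp α (0 + ε) X ≫ _
    rw [reassoc_of% unitApp_extendComul, unitApp_extendTrans, extendCounit_naturality,
      reassoc_of% unitApp_extendCounit, ← Functor.map_comp_assoc, F.comul_counit_left]
  comul_counit_right ε P := by
    refine app_eq_of_app_yoneda_eq (α (ε + 0))
      (F.extendComul α ε 0 ≫ Functor.whiskerRight (F.extendCounit α) (L ε))
      (F.extendTrans α (add_zero ε).ge) (fun X => ?_) P
    change unitApp α (ε + 0) X ≫ (F.extendComul α ε 0).app _ ≫
      (L ε).map ((F.extendCounit α).app _) = unitApp α (ε + 0) X ≫ _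
    rw [reassoc_of% unitApp_extendComul, unitApp_extendTrans, ← Functor.map_comp,
      unitApp_extendCounit, unitApp_naturality, ← Functor.map_comp_assoc, F.comul_counit_right]
    rfl
  coassoc ε ζ δ P := by
    refine app_eq_of_app_yoneda_eq (α (ε + ζ + δ))
      (F.extendComul α (ε + ζ) δ ≫ Functor.whiskerLeft (L δ) (F.extendComul α ε ζ))
      (F.extendTrans α (add_assoc ε ζ δ).ge ≫ F.extendComul α ε (ζ + δ) ≫
        Functor.whiskerRight (F.extendComul α ζ δ) (L ε)) (fun X => ?_) P
    change unitApp α (ε + ζ + δ) X ≫ (F.extendComul α (ε + ζ) δ).app _ ≫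
        (F.extendComul α ε ζ).app ((L δ).obj _) =
      unitApp α (ε + ζ + δ) X ≫ (F.extendTrans α _).app _ ≫
        (F.extendComul α ε (ζ + δ)).app _ ≫ (L ε).map ((F.extendComul α ζ δ).app _)
    rw [reassoc_of% unitApp_extendComul, extendComul_naturality, reassoc_of% unitApp_extendComul,
      reassoc_of% unitApp_extendTrans, reassoc_of% unitApp_extendComul,
      ← Functor.map_comp (L ε) (unitApp α (ζ + δ) X), unitApp_extendComul,
      Functor.map_comp (L ε), Functor.map_comp (L ε),
      reassoc_of% unitApp_naturality]
    simp only [← Functor.map_comp_assoc]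
    rw [F.coassoc]
    rfl
  trans_comul {ε δ ζ κ} h₁ h₂ P := by
    refine app_eq_of_app_yoneda_eq (α (δ + κ))
      (F.extendTrans α (add_le_add h₁ h₂) ≫ F.extendComul α ε ζ)
      (F.extendComul α δ κ ≫ Functor.whiskerLeft (L κ) (F.extendTrans α h₁) ≫
        Functor.whiskerRight (F.extendTrans α h₂) (L ε)) (fun X => ?_) P
    change unitApp α (δ + κ) X ≫ (F.extendTrans α _).app _ ≫ (F.extendComul α ε ζ).app _ =
      unitApp α (δ + κ) X ≫ (F.extendComul α δ κ).app _ ≫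
        (F.extendTrans α h₁).app ((L κ).obj _) ≫ (L ε).map ((F.extendTrans α h₂).app _)
    rw [reassoc_of% unitApp_extendTrans, unitApp_extendComul, reassoc_of% unitApp_extendComul,
      NatTrans.naturality_assoc, reassoc_of% unitApp_extendTrans, ← Functor.map_comp (L ε),
      unitApp_extendTrans, Functor.map_comp (L ε), reassoc_of% unitApp_naturality]
    simp only [← Functor.map_comp_assoc]
    rw [F.trans_comul]

lemma equivariantVia_extend : F.EquivariantVia (F.extend α) yoneda α where
  counit X := F.unitApp_extendCounit α X
  trans h X := F.unitApp_extendTrans α h X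
  comul ε δ X := F.unitApp_extendComul α ε δ X

/-- If the comultiplications of a coflow are invertible, then so are those of its extension to
presheaves: source and target are left Kan extensions of isomorphic functors. -/
lemma isIso_comul_extend (hF : ∀ ε δ, IsIso (F.comul ε δ)) (ε δ : ℝ≥0) :
    IsIso ((F.extend α).comul ε δ) := by
  have hα (ε : ℝ≥0) := (isLeftKanExtension_yoneda_iff (α ε)).1 inferInstance
  have := (hα ε).1
  have := (hα δ).1
  have := (hα ε).2
  have := (hα δ).2
  have : IsIso (unitComp α ε δ) := by unfold unitComp; infer_instance
  rw [← Functor.isLeftKanExtension_iff_isIso ((F.extend α).comul ε δ) (α (ε + δ))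
    (Functor.whiskerRight (F.comul ε δ) yoneda ≫ unitComp α ε δ)
    ((L (ε + δ)).descOfIsLeftKanExtension_fac _ _ _), isLeftKanExtension_yoneda_iff]
  exact ⟨inferInstance, inferInstance⟩

/-- The extension of a coflow with invertible comultiplications to presheaves is metrically
complete. -/
theorem metricallyComplete_extend (hF : ∀ ε δ, IsIso (F.comul ε δ)) :
    (F.extend α).MetricallyComplete :=
  (F.extend α).metricallyComplete_of_isLeftAdjoint
    (fun ε => isLeftAdjoint_of_isLeftKanExtension_yoneda (α ε)) (F.isIso_comul_extend α hF)

lemma IsStrict.isIso_comul {F : Coflow T} (hF : F.IsStrict) (ε δ : ℝ≥0) :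
    IsIso (F.comul ε δ) := by
  obtain ⟨h, e⟩ := hF.comul_eq ε δ
  rw [e]
  infer_instance

end Coflow
end Extend

/-! ### Existence of pointwise and of strict extensions -/

section Choice

variable {C : Type u} [SmallCategory C]

lemma IsYonedaKanExtension.isLeftKanExtension {T : C ⥤ C}
    {L : (Cᵒᵖ ⥤ Type u) ⥤ (Cᵒᵖ ⥤ Type u)} {α : T ⋙ yoneda ⟶ yoneda ⋙ L}
    (h : IsYonedaKanExtension T L α) : L.IsLeftKanExtension α :=
  h.some.isLeftKanExtension

lemma exists_isYonedaKanExtension (T : C ⥤ C) :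
    ∃ (L : (Cᵒᵖ ⥤ Type u) ⥤ (Cᵒᵖ ⥤ Type u)) (α : T ⋙ yoneda ⟶ yoneda ⋙ L),
      IsYonedaKanExtension T L α :=
  ⟨_, _, ⟨yoneda.pointwiseLeftKanExtensionIsPointwiseLeftKanExtension (T ⋙ yoneda)⟩⟩

lemma IsYonedaKanExtension.of_iso {T : C ⥤ C} {L L' : (Cᵒᵖ ⥤ Type u) ⥤ (Cᵒᵖ ⥤ Type u)}
    {α : T ⋙ yoneda ⟶ yoneda ⋙ L} {α' : T ⋙ yoneda ⟶ yoneda ⋙ L'}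
    (h : IsYonedaKanExtension T L α) (e : L ≅ L')
    (he : ∀ X, α.app X ≫ e.hom.app (yoneda.obj X) = α'.app X) : IsYonedaKanExtension T L' α' :=
  ⟨Functor.LeftExtension.isPointwiseLeftKanExtensionEquivOfIso
    (StructuredArrow.isoMk e (by ext1; ext1 X; exact he X)) h.some⟩

/-- The identity functor is a strict extension of the identity functor, by density of the
representable presheaves. -/
lemma isYonedaKanExtension_id {T : C ⥤ C} (hT : T = 𝟭 C) :
    ∃ h : T ⋙ yoneda = yoneda ⋙ 𝟭 (Cᵒᵖ ⥤ Type u),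
      IsYonedaKanExtension T (𝟭 _) (eqToHom h) := by
  subst hT
  exact ⟨rfl, ⟨fun P => (yoneda (C := C)).denseAt P⟩⟩

/-- If the Yoneda embedding is injective on objects, then a pointwise left Kan extension can be
altered on the representable presheaves so that it strictly extends the given functor. -/
lemma exists_strict_isYonedaKanExtension (hinj : Function.Injective (yoneda (C := C)).obj)
    (T : C ⥤ C) :
    ∃ (L : (Cᵒᵖ ⥤ Type u) ⥤ (Cᵒᵖ ⥤ Type u)) (h : T ⋙ yoneda = yoneda ⋙ L),
      IsYonedaKanExtension T L (eqToHom h) := by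
  classical
  obtain ⟨L, α, hα⟩ := exists_isYonedaKanExtension T
  have hiso : IsIso α := hα.some.isIso_hom
  -- the new value at each presheaf, with an isomorphism from the old value that is the inverse
  -- of the unit at representables
  have key (P : Cᵒᵖ ⥤ Type u) : ∃ (Q : Cᵒᵖ ⥤ Type u) (e : L.obj P ≅ Q),
      ∀ (X : C) (hX : yoneda.obj X = P), ∃ hQ : yoneda.obj (T.obj X) = Q,
        α.app X ≫ L.map (eqToHom hX) ≫ e.hom = eqToHom hQ := by
    by_cases hP : ∃ X : C, yoneda.obj X = P
    · obtain ⟨X, rfl⟩ := hP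
      refine ⟨yoneda.obj (T.obj X), (asIso (α.app X)).symm, fun Y hY => ?_⟩
      obtain rfl := hinj hY
      exact ⟨rfl, by simp⟩
    · exact ⟨L.obj P, Iso.refl _, fun X hX => (hP ⟨X, hX⟩).elim⟩
  choose obj e he using key
  have he' (X : C) : ∃ hQ : yoneda.obj (T.obj X) = obj (yoneda.obj X),
      α.app X ≫ (e (yoneda.obj X)).hom = eqToHom hQ := by
    obtain ⟨hQ, h⟩ := he _ X rfl
    exact ⟨hQ, by simpa using h⟩
  choose hQ hu using he'
  have h : T ⋙ yoneda = yoneda ⋙ L.copyObj obj e := by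
    refine CategoryTheory.Functor.ext hQ fun X Y f => ?_
    have hn : yoneda.map (T.map f) ≫ α.app Y = α.app X ≫ L.map (yoneda.map f) :=
      α.naturality f
    change yoneda.map (T.map f) = eqToHom (hQ X) ≫ ((e (yoneda.obj X)).inv ≫
      L.map (yoneda.map f) ≫ (e (yoneda.obj Y)).hom) ≫ eqToHom (hQ Y).symm
    have hY : α.app Y ≫ (e (yoneda.obj Y)).hom ≫ eqToHom (hQ Y).symm = 𝟙 _ := by
      rw [reassoc_of% hu Y, eqToHom_trans, eqToHom_refl]
      rfl
    rw [← hu X]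
    simp only [Category.assoc, Iso.hom_inv_id_assoc]
    rw [← reassoc_of% hn, hY]
    exact (Category.comp_id _).symm
  refine ⟨L.copyObj obj e, h, hα.of_iso (L.isoCopyObj obj e) fun X => ?_⟩
  rw [eqToHom_app]
  exact hu X

end Choice

/-! ### The Yoneda completion -/

theorem mainTheorem3 {C : Type u} [SmallCategory C] {T : ℝ≥0 → C ⥤ C}
    (F : Coflow T) (hF : F.IsStrict) :
    -- the Yoneda embedding is full and faithful
    ((yoneda (C := C)).Full ∧ (yoneda (C := C)).Faithful) ∧
    -- the pointwise left Kan extensions exist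
    (∃ (L : ℝ≥0 → (Cᵒᵖ ⥤ Type u) ⥤ (Cᵒᵖ ⥤ Type u))
        (α : ∀ ε : ℝ≥0, T ε ⋙ yoneda ⟶ yoneda ⋙ L ε),
      ∀ ε : ℝ≥0, IsYonedaKanExtension (T ε) (L ε) (α ε)) ∧
    -- if the Yoneda embedding is injective on objects (as it is when hom-sets are pairwise
    -- disjoint), they can be chosen as strict extensions, with `L 0` the identity
    (Function.Injective (yoneda (C := C)).obj →
      ∃ (L : ℝ≥0 → (Cᵒᵖ ⥤ Type u) ⥤ (Cᵒᵖ ⥤ Type u))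
        (hL : ∀ ε : ℝ≥0, T ε ⋙ yoneda = yoneda ⋙ L ε),
        L 0 = 𝟭 (Cᵒᵖ ⥤ Type u) ∧
        ∀ ε : ℝ≥0, IsYonedaKanExtension (T ε) (L ε) (eqToHom (hL ε))) ∧
    -- for every strict choice, `L` carries a metrically complete coflow for which the Yoneda
    -- embedding is strictly coflow-equivariant
    (∀ (L : ℝ≥0 → (Cᵒᵖ ⥤ Type u) ⥤ (Cᵒᵖ ⥤ Type u))
        (hL : ∀ ε : ℝ≥0, T ε ⋙ yoneda = yoneda ⋙ L ε),
      (∀ ε : ℝ≥0, IsYonedaKanExtension (T ε) (L ε) (eqToHom (hL ε))) →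
      ∃ G : Coflow L, F.StrictEquivariant G yoneda ∧ G.MetricallyComplete) ∧
    -- for an arbitrary choice, the same holds with the (invertible) units of the Kan
    -- extensions in place of the equalities
    (∀ (L : ℝ≥0 → (Cᵒᵖ ⥤ Type u) ⥤ (Cᵒᵖ ⥤ Type u))
        (α : ∀ ε : ℝ≥0, T ε ⋙ yoneda ⟶ yoneda ⋙ L ε),
      (∀ ε : ℝ≥0, IsYonedaKanExtension (T ε) (L ε) (α ε)) →
      (∀ ε : ℝ≥0, IsIso (α ε)) ∧
      ∃ G : Coflow L, F.EquivariantVia G yoneda α ∧ G.MetricallyComplete) := by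
  have main (L : ℝ≥0 → (Cᵒᵖ ⥤ Type u) ⥤ (Cᵒᵖ ⥤ Type u))
      (α : ∀ ε : ℝ≥0, T ε ⋙ yoneda ⟶ yoneda ⋙ L ε)
      (h : ∀ ε : ℝ≥0, IsYonedaKanExtension (T ε) (L ε) (α ε)) :
      ∃ G : Coflow L, F.EquivariantVia G yoneda α ∧ G.MetricallyComplete := by
    have (ε : ℝ≥0) := (h ε).isLeftKanExtension
    exact ⟨F.extend α, F.equivariantVia_extend α, F.metricallyComplete_extend α hF.isIso_comul⟩
  refine ⟨⟨inferInstance, inferInstance⟩, ?_, fun hinj => ?_, fun L hL h => ?_, fun L α h => ?_⟩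
  · choose L α h using fun ε => exists_isYonedaKanExtension (T ε)
    exact ⟨L, α, h⟩
  -- strictness gives `T 0 = 𝟭 C`, so that the identity may be chosen for `ε = 0`
  · have key (ε : ℝ≥0) : ∃ (L : (Cᵒᵖ ⥤ Type u) ⥤ (Cᵒᵖ ⥤ Type u))
        (h : T ε ⋙ yoneda = yoneda ⋙ L),
        (ε = 0 → L = 𝟭 _) ∧ IsYonedaKanExtension (T ε) L (eqToHom h) := by
      by_cases hε : ε = 0
      · subst hε
        obtain ⟨h0, -⟩ := hF.counit_eq
        obtain ⟨h, h'⟩ := isYonedaKanExtension_id h0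
        exact ⟨_, h, fun _ => rfl, h'⟩
      · obtain ⟨L, h, h'⟩ := exists_strict_isYonedaKanExtension hinj (T ε)
        exact ⟨L, h, fun h0 => (hε h0).elim, h'⟩
    choose L hL h0 h using key
    exact ⟨L, hL, h0 0 rfl, h⟩
  · obtain ⟨G, hG, hc⟩ := main L _ h
    exact ⟨G, ⟨hL, hG⟩, hc⟩
  · exact ⟨fun ε => (h ε).some.isIso_hom, main L α h⟩
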